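/- Let $X,Y,Z$ be real locally convex Hausdorff topological vector spaces, let $K\subsetneq Y$ be a closed convex cone with $\operatorname{int}K\neq\emptyset$, let $S\subset Z$ be a nonempty closed convex cone, and let $\mathcal U$ be a nonempty set. **Conventions.** Let $Y^\bullet:=Y\cup\{-\infty_Y,+\infty_Y\}$. For $y_1,y_2\in Y$ write $y_1<_K y_2$ iff $y_1-y_2\in-\operatorname{int}K$, and let $-\infty_Y<_K y<_K+\infty_Y$ for all $y\in Y$ and $-\infty_Y<_K+\infty_Y$. Put $-(\pm\infty_Y)=\mp\infty_Y$, and let a sum of $+\infty_Y$ (respectively $-\infty_Y$) with an element of $Y$ or with itself be $+\infty_Y$ (respectively $-\infty_Y$). Likewise for $Z^\bullet$. For $M\subset Y^\bullet$, $\operatorname{WSup}M$ is the set of all $\bar v\in Y^\bullet$ such that $\bar v\not<_K v$ for all $v\in M$ and, for every $\tilde v\in Y^\bullet$ with $\tilde v<_K\bar v$, there is $v\in M$ with $\tilde v<_K v$. $\mathcal L(X,Y)$ is the space of continuous linear maps $X\to Y$ with the topology of pointwise convergence; $X^*$, $Y^*$ are the spaces of continuous linear functionals on $X$, $Y$. A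 map $F:X\to Y^\bullet$ has domain $\operatorname{dom}F=\{x:F(x)\ne+\infty_Y\}$ and $K$-epigraph $\{(x,y)\in X\times Y: y\in F(x)+K\}$. It is proper if $\operatorname{dom}F\neq\emptyset$ and $F$ never takes the value $-\infty_Y$; $K$-convex (respectively $K$-epi closed) if its $K$-epigraph is convex (respectively closed) in $X\times Y$; positively $K$-lsc if $y^*\circ F$ is lower semicontinuous for every $y^*\in Y^*\setminus\{0\}$ with $y^*\ge0$ on $K$ (where $y^*(\pm\infty_Y)=\pm\infty$). The corresponding notions for maps $X\to Z^\bullet$ and the cone $S$ are defined in the same way. For $D\subset X$ (or $D\subset Z$), $I_D$ is the map with values in $Y^\bullet$ equal to $0_Y$ on $D$ and $+\infty_Y$ off $D$. The conjugate is $F^*(L):=\operatorname{WSup}\{L(x)-F(x):x\in X\}$ for $L\in\mathcal L(X,Y)$, with $\operatorname{epi}F^*:=\{(L,y)\in\mathcal L(X,Y)\times Y: y\in F^*(L)+K\}$; conjugates of maps $Z\to Y^\bullet$ are defined in the same way. For $T\in\mathcal L(Z,Y)$ and proper $G:X\to Z^\bullet$, $(T\circ G)(x)=T(G(x))$ if $G(x)\in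 Z$ and $+\infty_Y$ if $G(x)=+\infty_Z$. For $k\in\operatorname{int}K$ let $E_k:=\{(x\mapsto x^*(x)k,\; rk): x^*\in X^*,\ r\in\mathbb R\}\subset\mathcal L(X,Y)\times Y$. A set $N\subset\mathcal L(X,Y)\times Y$ is $k$-sectionally convex if $N\cap(E_k+e)$ is convex for every $e\in\mathcal L(X,Y)\times Y$, and $\operatorname{sco}_kN$ is the intersection of all $k$-sectionally convex sets containing $N$. **Data.** Let $F:X\to Y^\bullet$ and $G_u:X\to Z^\bullet$ ($u\in\mathcal U$) be proper, let $C\subset X$, set $A:=C\cap\bigcap_{u\in\mathcal U}G_u^{-1}(-S)$, and assume $A\cap\operatorname{dom}F\ne\emptyset$. Let $$\mathcal L_+(S,K)=\{T\in\mathcal L(Z,Y):T(S)\subset K\},\qquad \mathcal L_+^w(S,K)=\{T\in\mathcal L(Z,Y):T(S)\cap(-\operatorname{int}K)=\emptyset\},$$ $$\mathcal A=\bigcup_{(T,u)\in\mathcal L_+(S,K)\times\mathcal U}\operatorname{epi}(F+I_C+T\circ G_u)^*,$$ $$\mathcal B=\bigcup_{(T,u)\in\mathcal L^w_+(S,K)\times\mathcal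 U}\ \bigcap_{v\in I_{-S}^*(T)}\big[\operatorname{epi}(F+I_C+T\circ G_u)^*+(0,v)\big]$$ (for $T\in\mathcal L^w_+(S,K)$ one has $I^*_{-S}(T)\subset Y$). **Theorem.** Assume $(\mathcal H_0)$: $F$ is $K$-convex and positively $K$-lsc, each $G_u$ ($u\in\mathcal U$) is $S$-convex and $S$-epi closed, and $C$ is nonempty, closed and convex. Then for every $k\in\operatorname{int}K$, $$\operatorname{epi}(F+I_A)^*=\operatorname{cl}(\operatorname{sco}_k\mathcal B)=\operatorname{cl}(\operatorname{sco}_k\mathcal A),$$ the closures being taken in $\mathcal L(X,Y)\times Y$. -/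

import Mathlib

open scoped Pointwise

namespace RobustVector

/-! ### The extended space `Y• = Y ∪ {-∞_Y, +∞_Y}` -/

/-- The space `Y` enlarged by a smallest element `-∞_Y` and a greatest element `+∞_Y`. -/
inductive Ext (Y : Type*) where
  | negInf : Ext Y
  | fin (y : Y) : Ext Y
  | posInf : Ext Y

namespace Ext

variable {Y : Type*}

/-- Addition on `Y•`. The sums `(-∞) + (+∞)` and `(+∞) + (-∞)` are never considered; they receive
an arbitrary value. -/
def add [Add Y] : Ext Y → Ext Y → Ext Y
  | negInf, _ => negInf
  | fin _, negInf => negInf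
  | fin a, fin b => fin (a + b)
  | fin _, posInf => posInf
  | posInf, negInf => negInf
  | posInf, fin _ => posInf
  | posInf, posInf => posInf

instance [Add Y] : Add (Ext Y) := ⟨Ext.add⟩

/-- Negation on `Y•`: `-(+∞) = -∞` and `-(-∞) = +∞`. -/
def neg [Neg Y] : Ext Y → Ext Y
  | negInf => posInf
  | fin a => fin (-a)
  | posInf => negInf

instance [Neg Y] : Neg (Ext Y) := ⟨Ext.neg⟩

/-- Extension of a map `f : Y → W` to `Y• → W•` preserving the infinite elements. -/
def map {W : Type*} (f : Y → W) : Ext Y → Ext W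
  | negInf => negInf
  | fin a => fin (f a)
  | posInf => posInf

/-- Extension of a real-valued map on `Y` to a map from `Y•` to the extended reals. -/
noncomputable def toEReal (f : Y → ℝ) : Ext Y → EReal
  | negInf => ⊥
  | fin a => (f a : EReal)
  | posInf => ⊤

end Ext

section Order

variable {Y : Type*} [AddCommGroup Y] [Module ℝ Y] [TopologicalSpace Y]

/-- The weak ordering `<_K` on `Y•`: `y₁ <_K y₂` iff `y₁ - y₂ ∈ -int K` on `Y`, while
`-∞ <_K y <_K +∞` for `y ∈ Y`, and `-∞ <_K +∞`. -/
def WLt (K : ProperCone ℝ Y) : Ext Y → Ext Y → Prop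
  | .negInf, .negInf => False
  | .negInf, .fin _ => True
  | .negInf, .posInf => True
  | .fin _, .negInf => False
  | .fin y₁, .fin y₂ => y₁ - y₂ ∈ -interior (K : Set Y)
  | .fin _, .posInf => True
  | .posInf, _ => False

/-- The set `WSup M` of weakly supremal elements of `M ⊆ Y•`
(for `M = ∅` this gives `{-∞_Y}`, the usual convention). -/
def wSup (K : ProperCone ℝ Y) (M : Set (Ext Y)) : Set (Ext Y) :=
  {w | (∀ v ∈ M, ¬ WLt K w v) ∧ ∀ w', WLt K w' w → ∃ v ∈ M, WLt K w' v}

end Order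

section Maps

variable {X Y : Type*}

/-- The effective domain of `F : X → Y•`. -/
def dom (F : X → Ext Y) : Set X := {x | F x ≠ .posInf}

/-- `F` is proper if its domain is nonempty and it never takes the value `-∞`. -/
def IsProper (F : X → Ext Y) : Prop := (dom F).Nonempty ∧ ∀ x, F x ≠ .negInf

open Classical in
/-- The indicator map `I_D : X → Y•`, equal to `0_Y` on `D` and `+∞_Y` outside. -/
noncomputable def indicator [Zero Y] (D : Set X) (x : X) : Ext Y :=
  if x ∈ D then .fin 0 else .posInf

variable [AddCommGroup Y] [Module ℝ Y] [TopologicalSpace Y]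

/-- The `K`-epigraph `{(x, y) ∈ X × Y : y ∈ F(x) + K}` of `F : X → Y•`. -/
def epi (K : ProperCone ℝ Y) (F : X → Ext Y) : Set (X × Y) :=
  {p | ∃ c ∈ K, Ext.fin p.2 = F p.1 + Ext.fin c}

/-- `F` is `K`-convex if its `K`-epigraph is convex. -/
def KConvex [AddCommGroup X] [Module ℝ X] (K : ProperCone ℝ Y) (F : X → Ext Y) : Prop :=
  Convex ℝ (epi K F)

/-- `F` is `K`-epi closed if its `K`-epigraph is closed. -/
def KEpiClosed [TopologicalSpace X] (K : ProperCone ℝ Y) (F : X → Ext Y) : Prop :=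
  IsClosed (epi K F)

/-- `F` is positively `K`-lsc if `y* ∘ F` is lower semicontinuous for every nonzero `y*` in the
dual cone `K⁺ = {y* ∈ Y* : y*(y) ≥ 0 for all y ∈ K}`. -/
def PositivelyLsc [TopologicalSpace X] (K : ProperCone ℝ Y) (F : X → Ext Y) : Prop :=
  ∀ φ : Y →L[ℝ] ℝ, (∀ y ∈ K, 0 ≤ φ y) → φ ≠ 0 →
    LowerSemicontinuous fun x => (F x).toEReal φ

end Maps

/-! ### Conjugates

`X →Lₚₜ[ℝ] Y` is the space `ℒ(X, Y)` of continuous linear maps with the topology of pointwise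
convergence. -/

section Conjugate

variable {X Y : Type*} [AddCommGroup X] [Module ℝ X] [TopologicalSpace X]
  [AddCommGroup Y] [Module ℝ Y] [TopologicalSpace Y]

/-- The conjugate `F*(L) = WSup {L(x) - F(x) : x ∈ X}`, a set-valued map `ℒ(X, Y) ⇉ Y•`. -/
def conj (K : ProperCone ℝ Y) (F : X → Ext Y) (L : X →Lₚₜ[ℝ] Y) : Set (Ext Y) :=
  wSup K (Set.range fun x => Ext.fin (L x) + -F x)

/-- The `K`-epigraph `{(L, y) ∈ ℒ(X, Y) × Y : y ∈ F*(L) + K}` of the conjugate `F*`. -/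
noncomputable def epiConj (K : ProperCone ℝ Y) (F : X → Ext Y) : Set ((X →Lₚₜ[ℝ] Y) × Y) :=
  {p | ∃ w ∈ conj K F p.1, ∃ c ∈ K, Ext.fin p.2 = w + Ext.fin c}

end Conjugate

/-! ### Sectional convexity -/

section Sectional

variable {E : Type*} [AddCommGroup E] [Module ℝ E]

/-- `N` is `E₀`-sectionally convex if `N ∩ (E₀ + v)` is convex for all `v ∈ E`. -/
def SectionallyConvex (E₀ : Submodule ℝ E) (N : Set E) : Prop :=
  ∀ v : E, Convex ℝ (N ∩ ((E₀ : Set E) + {v}))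

/-- The `E₀`-sectionally convex hull: the intersection of all `E₀`-sectionally convex sets
containing `N`. -/
def sectionalHull (E₀ : Submodule ℝ E) (N : Set E) : Set E :=
  ⋂₀ {M | N ⊆ M ∧ SectionallyConvex E₀ M}

end Sectional

section Data

variable {X Y Z : Type*}
  [AddCommGroup X] [Module ℝ X] [TopologicalSpace X]
  [AddCommGroup Y] [Module ℝ Y] [TopologicalSpace Y] [IsTopologicalAddGroup Y]
  [ContinuousSMul ℝ Y]
  [AddCommGroup Z] [Module ℝ Z] [TopologicalSpace Z]

/-- The subspace `E_k = {(k · x*, r k) : x* ∈ X*, r ∈ ℝ}` of `ℒ(X, Y) × Y`, where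
`(k · x*)(x) = x*(x) k`. -/
noncomputable def directionSpace (X : Type*) [AddCommGroup X] [Module ℝ X] [TopologicalSpace X]
    [IsTopologicalAddGroup X] [ContinuousSMul ℝ X] (k : Y) :
    Submodule ℝ ((X →Lₚₜ[ℝ] Y) × Y) where
  carrier := {p | ∃ (ξ : X →L[ℝ] ℝ) (r : ℝ), (∀ x, p.1 x = ξ x • k) ∧ p.2 = r • k}
  zero_mem' := ⟨0, 0, fun x => by simp, by simp⟩
  add_mem' := by
    rintro p q ⟨ξ, r, h₁, h₂⟩ ⟨η, s, h₃, h₄⟩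
    exact ⟨ξ + η, r + s, fun x => by simp [h₁, h₃, add_smul], by simp [h₂, h₄, add_smul]⟩
  smul_mem' := by
    rintro c p ⟨ξ, r, h₁, h₂⟩
    exact ⟨c • ξ, c * r, fun x => by simp [h₁, mul_smul], by simp [h₂, mul_smul]⟩

/-- The `k`-sectionally convex hull in `ℒ(X, Y) × Y`. -/
noncomputable def sco [IsTopologicalAddGroup X] [ContinuousSMul ℝ X] (k : Y)
    (N : Set ((X →Lₚₜ[ℝ] Y) × Y)) : Set ((X →Lₚₜ[ℝ] Y) × Y) :=
  sectionalHull (directionSpace X k) N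

/-- The cone `ℒ₊(S, K)` of positive operators. -/
noncomputable def posOperators (S : ProperCone ℝ Z) (K : ProperCone ℝ Y) : Set (Z →Lₚₜ[ℝ] Y) :=
  {T | T '' (S : Set Z) ⊆ (K : Set Y)}

/-- The cone `ℒ₊ʷ(S, K)` of weak positive operators. -/
noncomputable def weakPosOperators (S : ProperCone ℝ Z) (K : ProperCone ℝ Y) : Set (Z →Lₚₜ[ℝ] Y) :=
  {T | T '' (S : Set Z) ∩ -interior (K : Set Y) = ∅}

/-- The composition `T ∘ G : X → Y•` of `G : X → Z•` with `T ∈ ℒ(Z, Y)`. -/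
noncomputable def opComp (T : Z →Lₚₜ[ℝ] Y) (G : X → Ext Z) (x : X) : Ext Y := (G x).map T

/-- The feasible set `A = C ∩ ⋂_u G_u⁻¹(-S)`. -/
def feasible {U : Type*} (S : ProperCone ℝ Z) (G : U → X → Ext Z) (C : Set X) : Set X :=
  C ∩ ⋂ u, G u ⁻¹' (Ext.fin '' (-(S : Set Z)))

/-- The qualifying set
`𝒜 = ⋃_{(T, u) ∈ ℒ₊(S, K) × U} epi (F + I_C + T ∘ G_u)*`. -/
noncomputable def qualifyingSet {U : Type*} (K : ProperCone ℝ Y) (S : ProperCone ℝ Z) (F : X → Ext Y)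
    (G : U → X → Ext Z) (C : Set X) : Set ((X →Lₚₜ[ℝ] Y) × Y) :=
  ⋃ T ∈ posOperators S K, ⋃ u : U, epiConj K (F + indicator C + opComp T (G u))

/-- The weak qualifying set
`ℬ = ⋃_{(T, u) ∈ ℒ₊ʷ(S, K) × U} ⋂_{v ∈ I_{-S}*(T)} [epi (F + I_C + T ∘ G_u)* + (0, v)]`.
(For `T ∈ ℒ₊ʷ(S, K)` the set `I_{-S}*(T)` is contained in `Y`.) -/
noncomputable def weakQualifyingSet {U : Type*} (K : ProperCone ℝ Y) (S : ProperCone ℝ Z) (F : X → Ext Y)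
    (G : U → X → Ext Z) (C : Set X) : Set ((X →Lₚₜ[ℝ] Y) × Y) :=
  ⋃ T ∈ weakPosOperators S K, ⋃ u : U,
    ⋂ v ∈ {v : Y | Ext.fin v ∈ conj K (indicator (-(S : Set Z))) T},
      (epiConj K (F + indicator C + opComp T (G u)) + {((0 : X →Lₚₜ[ℝ] Y), v)})

end Data

end RobustVector

/-! The three sets are tied by a cycle of inclusions: `cl sco 𝒜 ⊆ cl sco ℬ ⊆ epi (F + I_A)* ⊆ cl sco
𝒜`.

Everything rests on `mem_epiConj_iff`, which removes `WSup`: for a proper map `H`, `(L, y)` lies in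
`epi H*` iff no value `L x - H x - y` is in `int K`. Hence `epi (F + I_A)*` is closed for pointwise
convergence. On a coset of `E_k` each condition reads `z + s k ∉ int K` with `s` depending affinely
on the point; the admissible `s` form a down-closed set, so the epigraph is also sectionally convex.
As it contains `ℬ` (weak duality), it contains `cl sco ℬ`; and `𝒜 ⊆ ℬ`.

The remaining inclusion reduces to scalars. Given `(L, y)` in the epigraph, separating a convex set
from `int K` yields `φ ∈ K⁺` with `φ k = 1` and `φ ∘ L - φ y ≤ φ ∘ F` on `A`. Let `B` be the union
of the conjugate epigraphs of the scalar Lagrangians `φ ∘ F + I_C + ζ ∘ G_u`, `ζ ∈ S⁺`. By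
separation, the supremum of the affine functions in `B` is at least `φ ∘ F + I_A`
(`mem_feasible_of_forall_le`), so `(φ ∘ L, φ y)` lies in the weak-star closed convex hull of `B`
(`mem_closure_convexHull_of_forall_le`). The continuous affine map `sectionMap` sends this point to
`(L, y)`, sends `B` into `𝒜` through the rank-one operators `z ↦ ζ(z) k`, and has its image in a
single coset of `E_k`; so the closed convex hull of `B` lands in `cl sco 𝒜`. -/

namespace RobustVector

/-! ### Scalar duality: weak-star separation and affine minorants -/

section Scalar

variable {X : Type*} [AddCommGroup X] [Module ℝ X] [TopologicalSpace X]

instance continuousSMul_pointwise : ContinuousSMul ℝ (X →Lₚₜ[ℝ] ℝ) :=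
  ⟨PointwiseConvergenceCLM.continuous_of_continuous_eval fun x =>
    continuous_fst.smul ((PointwiseConvergenceCLM.evalCLM _ ℝ x).continuous.comp continuous_snd)⟩

/-- Every continuous linear functional on `ℒ(X, ℝ) × ℝ` is of the form `(ξ, r) ↦ ξ x + α r`. -/
theorem exists_eval_of_continuousLinear_prod (f : ((X →Lₚₜ[ℝ] ℝ) × ℝ) →L[ℝ] ℝ) :
    ∃ (x : X) (α : ℝ), ∀ ξ r, f (ξ, r) = ξ x + α * r := by
  obtain ⟨x, hx⟩ := LinearMap.dualEmbedding_surjective (topDualPairing ℝ X)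
    ((f.comp (ContinuousLinearMap.inl ℝ _ ℝ)).comp
      ((PointwiseConvergenceCLM.equivWeakDual ℝ X).symm : WeakDual ℝ X →L[ℝ] (X →Lₚₜ[ℝ] ℝ)))
  refine ⟨x, f (0, 1), fun ξ r => ?_⟩
  have h₁ : f (ξ, 0) = ξ x := by
    have := congrArg (fun g => g (PointwiseConvergenceCLM.equivWeakDual ℝ X ξ)) hx
    exact this.symm
  have h₂ : ((ξ, r) : (X →Lₚₜ[ℝ] ℝ) × ℝ) = (ξ, 0) + r • (0, 1) := by
    ext <;> simp
  rw [h₂, map_add, map_smul, h₁, smul_eq_mul, mul_comm]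

/-- A point whose evaluation is dominated by the support function of an upward closed set `B` of
affine functionals belongs to the weak-star closed convex hull of `B`. -/
theorem mem_closure_convexHull_of_forall_le {B : Set ((X →Lₚₜ[ℝ] ℝ) × ℝ)} (hne : B.Nonempty)
    (hup : ∀ p ∈ B, ∀ t : ℝ, 0 ≤ t → (p.1, p.2 + t) ∈ B) {a : X} {m : ℝ}
    (ha : ∀ p ∈ B, p.1 a - p.2 ≤ m) {q : (X →Lₚₜ[ℝ] ℝ) × ℝ}
    (hq : ∀ x M, (∀ p ∈ B, p.1 x - p.2 ≤ M) → q.1 x - q.2 ≤ M) :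
    q ∈ closure (convexHull ℝ B) := by
  by_contra hcon
  obtain ⟨f, u, hfq, hfB⟩ := geometric_hahn_banach_point_closed
    ((convex_convexHull ℝ B).closure) isClosed_closure hcon
  obtain ⟨x, α, hf⟩ := exists_eval_of_continuousLinear_prod f
  replace hfq : q.1 x + α * q.2 < u := by rw [← hf]; exact hfq
  replace hfB : ∀ p ∈ B, u < p.1 x + α * p.2 := fun p hp => by
    rw [← hf]; exact hfB p (subset_closure (subset_convexHull ℝ B hp))
  obtain ⟨p₀, hp₀⟩ := hne
  -- If `α < 0`, moving `p₀` upward lowers the functional exactly to `u`, which is excluded on `B`.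
  have hα : 0 ≤ α := by
    by_contra! hneg
    have h0 := hfB p₀ hp₀
    have h := hfB _ (hup p₀ hp₀ ((p₀.1 x + α * p₀.2 - u) / (-α))
      (div_nonneg (by linarith) (by linarith)))
    have e : α * ((p₀.1 x + α * p₀.2 - u) / (-α)) = -(p₀.1 x + α * p₀.2 - u) := by
      rw [div_neg, mul_neg, mul_div_cancel₀ _ hneg.ne]
    simp only [mul_add, e] at h
    linarith
  rcases hα.lt_or_eq with hα | rfl
  -- Non-vertical hyperplane: after division by `α`, it bounds all of `B` at the single point `-α⁻¹
  -- x`, but not `q`.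
  · have h := hq (-(α⁻¹ • x)) (-(α⁻¹ * u)) fun p hp => by
      have h := mul_le_mul_of_nonneg_left (hfB p hp).le (inv_nonneg.2 hα.le)
      rw [mul_add, inv_mul_cancel_left₀ hα.ne'] at h
      simp only [map_neg, map_smul, smul_eq_mul]
      linarith
    have h' := mul_lt_mul_of_pos_left hfq (inv_pos.2 hα)
    rw [mul_add, inv_mul_cancel_left₀ hα.ne'] at h'
    simp only [map_neg, map_smul, smul_eq_mul] at h
    linarith
  -- Vertical hyperplane: `B` is bounded by `m - t u` at `a - t x`, and `t → ∞` makes the same bound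
  -- fail for `q`. The point `a`, where the support function is finite, is what anchors this ray.
  · simp only [zero_mul, add_zero] at hfq hfB
    have key : ∀ t : ℝ, 0 ≤ t → t * (u - q.1 x) ≤ m + q.2 - q.1 a := fun t ht => by
      have h := hq (a - t • x) (m - t * u) fun p hp => by
        have h₁ := mul_le_mul_of_nonneg_left (hfB p hp).le ht
        have h₂ := ha p hp
        simp only [map_sub, map_smul, smul_eq_mul]
        linarith
      simp only [map_sub, map_smul, smul_eq_mul] at h
      linarith
    have hpos : 0 < u - q.1 x := by linarith
    have h := key ((|m + q.2 - q.1 a| + 1) / (u - q.1 x)) (by positivity)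
    rw [div_mul_cancel₀ _ hpos.ne'] at h
    linarith [le_abs_self (m + q.2 - q.1 a)]

variable [IsTopologicalAddGroup X] [ContinuousSMul ℝ X] [LocallyConvexSpace ℝ X]

/-- Separation of a point from a closed convex epigraph by a (possibly vertical) hyperplane. -/
theorem exists_separation_epigraph {E : Set (X × ℝ)} (hE : IsClosed E) (hconv : Convex ℝ E)
    (hne : E.Nonempty) (hup : ∀ x t, (x, t) ∈ E → ∀ s, t ≤ s → (x, s) ∈ E) {p : X × ℝ}
    (hp : p ∉ E) :
    ∃ (η : X →L[ℝ] ℝ) (β c : ℝ), 0 ≤ β ∧ (∀ x t, (x, t) ∈ E → c ≤ η x + β * t) ∧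
      η p.1 + β * p.2 < c := by
  obtain ⟨f, u, hfp, hfE⟩ := geometric_hahn_banach_point_closed hconv hE hp
  have hf : ∀ x t, f (x, t) = f.comp (ContinuousLinearMap.inl ℝ X ℝ) x + f (0, 1) * t := by
    intro x t
    have h₂ : ((x, t) : X × ℝ) = (x, 0) + t • (0, 1) := by ext <;> simp
    rw [h₂, map_add, map_smul, smul_eq_mul, mul_comm]; rfl
  refine ⟨f.comp (ContinuousLinearMap.inl ℝ X ℝ), f (0, 1), u, ?_, fun x t h => ?_, ?_⟩
  · by_contra! hneg
    obtain ⟨⟨x, t⟩, hxt⟩ := hne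
    have h0 := hfE _ hxt
    set β := f (0, 1)
    have h := hfE _ (hup x t hxt (t + (f (x, t) - u) / (-β))
      (by linarith [div_nonneg (a := f (x, t) - u) (b := -β) (by linarith) (by linarith)]))
    have e : β * ((f (x, t) - u) / (-β)) = -(f (x, t) - u) := by
      rw [div_neg, mul_neg, mul_div_cancel₀ _ hneg.ne]
    have h1 := hf x t
    rw [hf, mul_add, e] at h
    linarith
  · rw [← hf]; exact (hfE _ h).le
  · rw [← hf]; exact hfp

/-- A closed convex proper epigraph is the intersection of the epigraphs of its continuous affine
minorants. -/
theorem exists_affine_minorant_gt {E : Set (X × ℝ)} (hE : IsClosed E) (hconv : Convex ℝ E)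
    (hup : ∀ x t, (x, t) ∈ E → ∀ s, t ≤ s → (x, s) ∈ E) {a : X} {b c : ℝ}
    (hab : (a, b) ∈ E) (hac : (a, c) ∉ E) {x₀ : X} {M : ℝ} (hx₀ : (x₀, M) ∉ E) :
    ∃ (ξ : X →L[ℝ] ℝ) (r : ℝ), (∀ x t, (x, t) ∈ E → ξ x - r ≤ t) ∧ M < ξ x₀ - r := by
  obtain ⟨η₁, β₁, c₁, hβ₁, h₁, h₁'⟩ := exists_separation_epigraph hE hconv ⟨_, hab⟩ hup hac
  obtain ⟨η₂, β₂, c₂, hβ₂, h₂, h₂'⟩ := exists_separation_epigraph hE hconv ⟨_, hab⟩ hup hx₀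
  -- The first hyperplane separates two points over the same `a`, so it cannot be vertical.
  have hβ₁' : 0 < β₁ := by
    refine hβ₁.lt_of_ne' fun h => ?_
    have := h₁ _ _ hab
    simp only [h, zero_mul] at this h₁'
    linarith
  simp only at h₂'
  -- The second hyperplane may be vertical; a small multiple of the first tilts it while keeping the
  -- strict gap at `(x₀, M)`.
  obtain ⟨ε, hε, hε'⟩ : ∃ ε > 0, 0 < c₂ - η₂ x₀ - β₂ * M + ε * (c₁ - η₁ x₀ - β₁ * M) := by
    set δ := c₂ - η₂ x₀ - β₂ * M
    set q := c₁ - η₁ x₀ - β₁ * M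
    have hδ : 0 < δ := by simp only [δ]; linarith
    refine ⟨δ / (1 + |q|), by positivity, ?_⟩
    have e : δ + δ / (1 + |q|) * q = δ / (1 + |q|) * (1 + |q| + q) := by
      field_simp
    rw [e]
    have := neg_abs_le q
    exact mul_pos (by positivity) (by linarith)
  have hβ : 0 < β₂ + ε * β₁ := by positivity
  refine ⟨-(β₂ + ε * β₁)⁻¹ • (η₂ + ε • η₁), -((β₂ + ε * β₁)⁻¹ * (c₂ + ε * c₁)),
    fun x t hxt => ?_, ?_⟩
  · have h := add_le_add (h₂ x t hxt) (mul_le_mul_of_nonneg_left (h₁ x t hxt) hε.le)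
    have h' := mul_le_mul_of_nonneg_left h (inv_nonneg.2 hβ.le)
    have e : (β₂ + ε * β₁)⁻¹ * (η₂ x + β₂ * t + ε * (η₁ x + β₁ * t)) =
      (β₂ + ε * β₁)⁻¹ * (η₂ x + ε * η₁ x) + t := by field_simp; ring
    rw [e] at h'
    simp only [smul_apply, add_apply, smul_eq_mul]
    linarith
  · have h' := mul_pos (inv_pos.2 hβ) hε'
    have e : (β₂ + ε * β₁)⁻¹ * (c₂ - η₂ x₀ - β₂ * M + ε * (c₁ - η₁ x₀ - β₁ * M)) =
      (β₂ + ε * β₁)⁻¹ * (c₂ + ε * c₁) - (β₂ + ε * β₁)⁻¹ * (η₂ x₀ + ε * η₁ x₀) - M := by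
      field_simp; ring
    rw [e] at h'
    simp only [smul_apply, add_apply, smul_eq_mul]
    linarith

end Scalar

/-! ### Interior of a closed convex cone -/

section Cone

variable {Y : Type*} [AddCommGroup Y] [Module ℝ Y] [TopologicalSpace Y] {K : ProperCone ℝ Y}

theorem cone_add_mem {a b : Y} (ha : a ∈ K) (hb : b ∈ K) : a + b ∈ K :=
  K.toPointedCone.add_mem ha hb

theorem cone_smul_mem {t : ℝ} (ht : 0 ≤ t) {a : Y} (ha : a ∈ K) : t • a ∈ K :=
  K.smul_mem ha ht

variable [IsTopologicalAddGroup Y]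

theorem add_mem_interior {a b : Y} (ha : a ∈ interior (K : Set Y)) (hb : b ∈ K) :
    a + b ∈ interior (K : Set Y) := by
  refine interior_maximal ?_ (isOpen_interior.add_right (t := {b})) (Set.add_mem_add ha rfl)
  rintro _ ⟨c, hc, _, rfl, rfl⟩
  exact cone_add_mem (interior_subset hc) hb

variable [ContinuousSMul ℝ Y]

omit [IsTopologicalAddGroup Y] in
theorem smul_mem_interior {t : ℝ} (ht : 0 < t) {a : Y} (ha : a ∈ interior (K : Set Y)) :
    t • a ∈ interior (K : Set Y) := by
  refine interior_maximal ?_ (isOpen_interior.smul₀ ht.ne') (Set.smul_mem_smul_set ha)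
  rintro _ ⟨c, hc, rfl⟩
  exact cone_smul_mem ht.le (interior_subset hc)

theorem exists_sub_smul_mem_interior {a : Y} (ha : a ∈ interior (K : Set Y)) (z : Y) :
    ∃ t : ℝ, 0 < t ∧ a - t • z ∈ interior (K : Set Y) := by
  have hc : Continuous fun t : ℝ => a - t • z := by fun_prop
  have h : ∀ᶠ t in nhds (0 : ℝ), a - t • z ∈ interior (K : Set Y) :=
    hc.continuousAt.eventually_mem (isOpen_interior.mem_nhds (by simpa using ha))
  obtain ⟨ε, hε, h⟩ := Metric.eventually_nhds_iff.1 h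
  refine ⟨ε / 2, by positivity, h ?_⟩
  rw [Real.dist_eq, sub_zero, abs_of_pos (by positivity)]
  linarith

theorem exists_smul_sub_mem_interior {k : Y} (hk : k ∈ interior (K : Set Y)) (z : Y) :
    ∃ t : ℝ, 0 < t ∧ t • k - z ∈ interior (K : Set Y) := by
  obtain ⟨t, ht, h⟩ := exists_sub_smul_mem_interior hk z
  refine ⟨t⁻¹, inv_pos.2 ht, ?_⟩
  have := smul_mem_interior (inv_pos.2 ht) h
  rwa [smul_sub, smul_smul, inv_mul_cancel₀ ht.ne', one_smul] at this

/-- A cone that is a neighbourhood of `0` absorbs every vector. -/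
theorem zero_notMem_interior (hK : (K : Set Y) ≠ Set.univ) : (0 : Y) ∉ interior (K : Set Y) := by
  refine fun h => hK (Set.eq_univ_of_forall fun z => ?_)
  obtain ⟨t, -, h⟩ := exists_smul_sub_mem_interior h (-z)
  simpa using interior_subset h

theorem mem_cone_of_forall_add_smul_mem {k z : Y} (h : ∀ ε : ℝ, 0 < ε → z + ε • k ∈ K) :
    z ∈ K := by
  have hc : Continuous fun t : ℝ => z + t • k := by fun_prop
  have hcl : IsClosed {t : ℝ | z + t • k ∈ (K : Set Y)} := K.isClosed.preimage hc
  have h0 : (0 : ℝ) ∈ closure (Set.Ioi (0 : ℝ)) := by simp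
  simpa using hcl.closure_subset_iff.2 (fun ε hε => h ε hε) h0

theorem pos_of_mem_interior {φ : Y →L[ℝ] ℝ} (hφ : ∀ c ∈ K, 0 ≤ φ c) (hφ0 : φ ≠ 0) {k : Y}
    (hk : k ∈ interior (K : Set Y)) : 0 < φ k := by
  obtain ⟨z, hz⟩ : ∃ z, 0 < φ z := by
    by_contra! hcon
    refine hφ0 (ContinuousLinearMap.ext fun z => le_antisymm (hcon z) ?_)
    simpa using hcon (-z)
  obtain ⟨t, ht, h⟩ := exists_smul_sub_mem_interior hk z
  have := hφ _ (interior_subset h)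
  rw [map_sub, map_smul, smul_eq_mul] at this
  exact pos_of_mul_pos_right (lt_of_lt_of_le hz (by linarith)) ht.le

end Cone

/-! ### Arithmetic in the extended space -/

section ExtLemmas

variable {Y : Type*}

@[simp] theorem fin_add_fin [Add Y] (a b : Y) : Ext.fin a + Ext.fin b = Ext.fin (a + b) := rfl

@[simp] theorem neg_fin [Neg Y] (a : Y) : -Ext.fin a = Ext.fin (-a) := rfl

theorem add_eq_fin_iff [Add Y] {v w : Ext Y} {y : Y} :
    v + w = Ext.fin y ↔ ∃ a b, v = .fin a ∧ w = .fin b ∧ a + b = y := by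
  constructor
  · intro h
    cases v <;> cases w <;> first | exact ⟨_, _, rfl, rfl, Ext.fin.inj h⟩ | cases h
  · rintro ⟨a, b, rfl, rfl, rfl⟩; rfl

theorem add_ne_negInf [Add Y] {v w : Ext Y} (hv : v ≠ .negInf) (hw : w ≠ .negInf) :
    v + w ≠ .negInf := by
  cases v <;> cases w <;> first | exact (hv rfl).elim | exact (hw rfl).elim | (intro h; cases h)

theorem neg_eq_fin_iff [InvolutiveNeg Y] {v : Ext Y} {y : Y} :
    -v = Ext.fin y ↔ v = .fin (-y) := by
  constructor
  · intro h
    cases v with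
    | fin a => rw [← Ext.fin.inj h, neg_neg]
    | negInf => cases h
    | posInf => cases h
  · rintro rfl; rw [neg_fin, neg_neg]

theorem indicator_eq_fin_iff {X : Type*} [Zero Y] {D : Set X} {x : X} {y : Y} :
    indicator D x = Ext.fin y ↔ x ∈ D ∧ y = 0 := by
  unfold indicator
  split_ifs with h
  · simp [h, eq_comm]
  · simp [h]

theorem indicator_ne_negInf {X : Type*} [Zero Y] {D : Set X} {x : X} :
    (indicator D x : Ext Y) ≠ .negInf := by
  unfold indicator; split_ifs <;> simp

theorem map_eq_fin_iff {W : Type*} {f : Y → W} {v : Ext Y} {w : W} :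
    v.map f = .fin w ↔ ∃ z, v = .fin z ∧ f z = w := by
  cases v <;> simp [Ext.map]

theorem exists_eq_fin {v : Ext Y} (h : v ≠ .negInf) (h' : v ≠ .posInf) : ∃ y, v = .fin y := by
  cases v
  · exact (h rfl).elim
  · exact ⟨_, rfl⟩
  · exact (h' rfl).elim

theorem mem_epi_iff {X : Type*} [AddCommGroup Y] [Module ℝ Y] [TopologicalSpace Y]
    {K : ProperCone ℝ Y} {F : X → Ext Y} {x : X} {y : Y} :
    (x, y) ∈ epi K F ↔ ∃ a, F x = .fin a ∧ y - a ∈ K := by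
  constructor
  · rintro ⟨c, hc, h⟩
    obtain ⟨a, b, ha, hb, h⟩ := add_eq_fin_iff.1 h.symm
    obtain rfl := Ext.fin.inj hb
    dsimp only at h
    exact ⟨a, ha, by rw [← h, add_sub_cancel_left]; exact hc⟩
  · rintro ⟨a, ha, h⟩
    exact ⟨y - a, h, by simp [ha]⟩

end ExtLemmas

/-! ### Existence of weakly supremal elements -/

section WSup

variable {Y : Type*} [AddCommGroup Y] [Module ℝ Y] [TopologicalSpace Y]

theorem wLt_fin_iff {K : ProperCone ℝ Y} {a b : Y} :
    WLt K (.fin a) (.fin b) ↔ b - a ∈ interior (K : Set Y) := by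
  simp [WLt]

variable [IsTopologicalAddGroup Y] [ContinuousSMul ℝ Y] {K : ProperCone ℝ Y}

/-- Below any upper bound `y` of `M` there is a weakly supremal element in the direction `-k`. -/
theorem exists_sub_smul_mem_wSup {k : Y} (hk : k ∈ interior (K : Set Y)) {M : Set (Ext Y)}
    (hpos : Ext.posInf ∉ M) {m : Y} (hm : Ext.fin m ∈ M) {y : Y}
    (hy : ∀ v, Ext.fin v ∈ M → v - y ∉ interior (K : Set Y)) :
    ∃ t : ℝ, 0 ≤ t ∧ Ext.fin (y - t • k) ∈ wSup K M := by
  -- The shifts `t` for which `y - t k` is still an upper bound; the supremum of this closed bounded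
  -- set gives the supremal element.
  set T : Set ℝ := {t | 0 ≤ t ∧ ∀ v, Ext.fin v ∈ M → v - (y - t • k) ∉ interior (K : Set Y)}
  have h0 : (0 : ℝ) ∈ T := ⟨le_rfl, by simpa using hy⟩
  have hcl : IsClosed T := by
    have : T = Set.Ici 0 ∩ ⋂ v, ⋂ _ : Ext.fin v ∈ M,
        {t : ℝ | v - (y - t • k) ∈ interior (K : Set Y)}ᶜ := by
      ext t; simp [T]
    rw [this]
    refine isClosed_Ici.inter (isClosed_iInter fun v => isClosed_iInter fun _ => ?_)
    exact (isOpen_interior.preimage (f := fun t : ℝ => v - (y - t • k)) (by fun_prop)).isClosed_compl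
  obtain ⟨t₁, -, ht₁⟩ := exists_smul_sub_mem_interior hk (y - m)
  have hbdd : BddAbove T := by
    refine ⟨t₁, fun t ht => ?_⟩
    by_contra! hlt
    refine ht.2 m hm ?_
    have := add_mem_interior ht₁ (cone_smul_mem (sub_nonneg.2 hlt.le) (interior_subset hk))
    convert this using 1
    module
  have hT := hcl.csSup_mem ⟨0, h0⟩ hbdd
  set t₀ := sSup T
  refine ⟨t₀, hT.1, fun v hv => ?_, fun w hw => ?_⟩
  · cases v with
    | negInf => exact id
    | fin v => rw [wLt_fin_iff]; exact hT.2 v hv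
    | posInf => exact (hpos hv).elim
  · cases w with
    | negInf => exact ⟨_, hm, trivial⟩
    | posInf => exact hw.elim
    | fin a =>
      rw [wLt_fin_iff] at hw
      -- The point `a` is still strictly below `y - (t₀ + ε) k`, which by maximality of `t₀` is no
      -- longer an upper bound.
      obtain ⟨ε, hε, h⟩ := exists_sub_smul_mem_interior hw k
      have hn : t₀ + ε ∉ T := fun h => by linarith [le_csSup hbdd h]
      simp only [T, Set.mem_ofPred_eq, not_and, not_forall, not_not] at hn
      obtain ⟨v, hv, hv'⟩ := hn (by linarith [hT.1])
      refine ⟨_, hv, wLt_fin_iff.2 ?_⟩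
      convert add_mem_interior hv' (interior_subset h) using 1
      module

end WSup

/-! ### Epigraphs of conjugates without `WSup` -/

section Conjugate

variable {X Y : Type*} [AddCommGroup X] [Module ℝ X] [TopologicalSpace X]
  [AddCommGroup Y] [Module ℝ Y] [TopologicalSpace Y] {K : ProperCone ℝ Y}

theorem fin_mem_range_iff {H : X → Ext Y} {L : X →Lₚₜ[ℝ] Y} {v : Y} :
    Ext.fin v ∈ Set.range (fun x => Ext.fin (L x) + -H x) ↔ ∃ x w, H x = .fin w ∧ v = L x - w := by
  simp only [Set.mem_range, add_eq_fin_iff, neg_eq_fin_iff]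
  constructor
  · rintro ⟨x, a, b, ha, hb, rfl⟩
    exact ⟨x, _, hb, by rw [Ext.fin.inj ha, sub_neg_eq_add]⟩
  · rintro ⟨x, w, hw, rfl⟩
    exact ⟨x, _, -w, rfl, by rw [neg_neg, hw], by abel⟩

theorem posInf_notMem_range {H : X → Ext Y} (hH : ∀ x, H x ≠ .negInf) {L : X →Lₚₜ[ℝ] Y} :
    Ext.posInf ∉ Set.range (fun x => Ext.fin (L x) + -H x) := by
  rintro ⟨x, hx⟩
  dsimp only at hx
  have := hH x
  cases h : H x with
  | negInf => exact this h
  | fin w => rw [h] at hx; cases hx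
  | posInf => rw [h] at hx; cases hx

variable [IsTopologicalAddGroup Y] [ContinuousSMul ℝ Y]

/-- The epigraph of the conjugate of a proper map, described by strict inequalities. -/
theorem mem_epiConj_iff {k : Y} (hk : k ∈ interior (K : Set Y)) {H : X → Ext Y}
    (hH : ∀ x, H x ≠ .negInf) (hdom : ∃ x w, H x = .fin w) {L : X →Lₚₜ[ℝ] Y} {y : Y} :
    (L, y) ∈ epiConj K H ↔ ∀ x w, H x = .fin w → L x - w - y ∉ interior (K : Set Y) := by
  constructor
  · rintro ⟨w, hw, c, hc, h⟩ x a hx hcon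
    obtain ⟨w₀, c', rfl, hc', h⟩ := add_eq_fin_iff.1 h.symm
    obtain rfl := Ext.fin.inj hc'
    refine hw.1 _ (fin_mem_range_iff.2 ⟨x, a, hx, rfl⟩) (wLt_fin_iff.2 ?_)
    dsimp only at h
    convert add_mem_interior hcon hc using 1
    rw [← h]; abel
  · intro h
    obtain ⟨x, w, hx⟩ := hdom
    obtain ⟨t, ht, hmem⟩ := exists_sub_smul_mem_wSup hk (posInf_notMem_range hH (L := L))
      (fin_mem_range_iff.2 ⟨x, w, hx, rfl⟩) (y := y) (by
        intro v hv
        obtain ⟨x, w, hx, rfl⟩ := fin_mem_range_iff.1 hv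
        exact h x w hx)
    exact ⟨_, hmem, t • k, cone_smul_mem ht (interior_subset hk), by simp⟩

end Conjugate

/-! ### Closedness, sectional convexity and weak duality -/

section Lagrangian

variable {X Y Z U : Type*} [AddCommGroup X] [Module ℝ X] [TopologicalSpace X]
  [AddCommGroup Y] [Module ℝ Y] [TopologicalSpace Y] [IsTopologicalAddGroup Y] [ContinuousSMul ℝ Y]
  [AddCommGroup Z] [Module ℝ Z] [TopologicalSpace Z]
  {K : ProperCone ℝ Y} {S : ProperCone ℝ Z} {F : X → Ext Y} {G : U → X → Ext Z} {C : Set X}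

omit [AddCommGroup X] [Module ℝ X] [TopologicalSpace X] in
-- Expressing the constraint through the closed convex set `epi S (G u)` makes convexity and
-- separation directly applicable.
theorem mem_feasible_iff {x : X} :
    x ∈ feasible S G C ↔ x ∈ C ∧ ∀ u, (x, (0 : Z)) ∈ epi S (G u) := by
  simp only [feasible, Set.mem_inter_iff, Set.mem_iInter, Set.mem_preimage, mem_epi_iff, zero_sub]
  refine and_congr_right fun _ => forall_congr' fun u => ?_
  constructor
  · rintro ⟨z, hz, h⟩; exact ⟨z, h.symm, hz⟩
  · rintro ⟨z, h, hz⟩; exact ⟨z, hz, h.symm⟩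

omit [TopologicalSpace X] in
theorem convex_feasible (hG : ∀ u, KConvex S (G u)) (hC : Convex ℝ C) :
    Convex ℝ (feasible S G C) := by
  intro x hx y hy a b ha hb hab
  rw [mem_feasible_iff] at *
  refine ⟨hC hx.1 hy.1 ha hb hab, fun u => ?_⟩
  simpa using hG u (hx.2 u) (hy.2 u) ha hb hab

theorem mem_epiConj_add_indicator_iff {k : Y} (hk : k ∈ interior (K : Set Y))
    (hF : ∀ x, F x ≠ .negInf) {D : Set X} (hD : (D ∩ dom F).Nonempty) {L : X →Lₚₜ[ℝ] Y} {y : Y} :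
    (L, y) ∈ epiConj K (F + indicator D) ↔
      ∀ x ∈ D, ∀ a, F x = .fin a → L x - a - y ∉ interior (K : Set Y) := by
  rw [mem_epiConj_iff (H := F + indicator D) hk
    (fun x => add_ne_negInf (hF x) indicator_ne_negInf)]
  · simp only [Pi.add_apply, add_eq_fin_iff, indicator_eq_fin_iff]
    constructor
    · intro h x hx a ha
      exact h x a ⟨a, 0, ha, ⟨hx, rfl⟩, add_zero a⟩
    · rintro h x _ ⟨a, _, ha, ⟨hx, rfl⟩, rfl⟩
      simpa using h x hx a ha
  · obtain ⟨x, hx, hx'⟩ := hD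
    obtain ⟨a, ha⟩ := exists_eq_fin (hF x) hx'
    exact ⟨x, a, add_eq_fin_iff.2 ⟨a, 0, ha, indicator_eq_fin_iff.2 ⟨hx, rfl⟩, add_zero a⟩⟩

theorem mem_epiConj_lagrangian_iff {k : Y} (hk : k ∈ interior (K : Set Y))
    (hF : ∀ x, F x ≠ .negInf) (hG : ∀ u x, G u x ≠ .negInf)
    (hA : (feasible S G C ∩ dom F).Nonempty) (T : Z →Lₚₜ[ℝ] Y) (u : U) {L : X →Lₚₜ[ℝ] Y} {y : Y} :
    (L, y) ∈ epiConj K (F + indicator C + opComp T (G u)) ↔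
      ∀ x ∈ C, ∀ a z, F x = .fin a → G u x = .fin z →
        L x - (a + T z) - y ∉ interior (K : Set Y) := by
  rw [mem_epiConj_iff hk]
  · simp only [Pi.add_apply, add_eq_fin_iff, indicator_eq_fin_iff, opComp, map_eq_fin_iff]
    constructor
    · intro h x hx a z ha hz
      exact h x _ ⟨a, T z, ⟨a, 0, ha, ⟨hx, rfl⟩, add_zero a⟩, ⟨z, hz, rfl⟩, rfl⟩
    · rintro h x _ ⟨_, _, ⟨a, _, ha, ⟨hx, rfl⟩, rfl⟩, ⟨z, hz, rfl⟩, rfl⟩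
      simpa using h x hx a z ha hz
  · refine fun x => add_ne_negInf (add_ne_negInf (hF x) indicator_ne_negInf) ?_
    have := hG u x
    unfold opComp
    cases h : G u x <;> simp_all [Ext.map]
  · obtain ⟨x, hx, hx'⟩ := hA
    obtain ⟨a, ha⟩ := exists_eq_fin (hF x) hx'
    obtain ⟨hxC, hxG⟩ := mem_feasible_iff.1 hx
    obtain ⟨z, hz, -⟩ := mem_epi_iff.1 (hxG u)
    exact ⟨x, _, add_eq_fin_iff.2 ⟨a, T z, add_eq_fin_iff.2 ⟨a, 0, ha,
      indicator_eq_fin_iff.2 ⟨hxC, rfl⟩, add_zero a⟩, map_eq_fin_iff.2 ⟨z, hz, rfl⟩, rfl⟩⟩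

theorem isClosed_epiConj_add_indicator {k : Y} (hk : k ∈ interior (K : Set Y))
    (hF : ∀ x, F x ≠ .negInf) {D : Set X} (hD : (D ∩ dom F).Nonempty) :
    IsClosed (epiConj K (F + indicator D)) := by
  have : epiConj K (F + indicator D) = ⋂ x ∈ D, ⋂ a, ⋂ _ : F x = .fin a,
      {p : (X →Lₚₜ[ℝ] Y) × Y | p.1 x - a - p.2 ∈ interior (K : Set Y)}ᶜ := by
    ext ⟨L, y⟩
    rw [mem_epiConj_add_indicator_iff hk hF hD]
    simp
  rw [this]
  refine isClosed_iInter fun x => isClosed_iInter fun _ => isClosed_iInter fun a =>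
    isClosed_iInter fun _ => (isOpen_interior.preimage ?_).isClosed_compl
  have : Continuous fun p : (X →Lₚₜ[ℝ] Y) × Y => p.1 x :=
    (PointwiseConvergenceCLM.evalCLM _ Y x).continuous.comp continuous_fst
  exact (this.sub continuous_const).sub continuous_snd

omit [ContinuousSMul ℝ Y] in
theorem add_smul_notMem_interior_of_le {k : Y} (hk : k ∈ interior (K : Set Y)) {z : Y} {s t : ℝ}
    (hst : s ≤ t) (h : z + t • k ∉ interior (K : Set Y)) : z + s • k ∉ interior (K : Set Y) := by
  refine fun h' => h ?_
  convert add_mem_interior h' (cone_smul_mem (sub_nonneg.2 hst) (interior_subset hk)) using 1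
  module

/-- Along a coset, each `x` imposes `z + s k ∉ int K` with `s = ξ x - r`. A convex combination of
two values of `s` is at most the larger one, and lowering `s` preserves the condition. -/
theorem sectionallyConvex_epiConj_add_indicator [IsTopologicalAddGroup X] [ContinuousSMul ℝ X]
    {k : Y} (hk : k ∈ interior (K : Set Y))
    (hF : ∀ x, F x ≠ .negInf) {D : Set X} (hD : (D ∩ dom F).Nonempty) :
    SectionallyConvex (directionSpace X k) (epiConj K (F + indicator D)) := by
  rintro v ⟨L₁, y₁⟩ ⟨h₁, d₁, ⟨ξ₁, r₁, hξ₁, hr₁⟩, v₁, hv₁, e₁⟩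
    ⟨L₂, y₂⟩ ⟨h₂, d₂, ⟨ξ₂, r₂, hξ₂, hr₂⟩, v₂, hv₂, e₂⟩ a b ha hb hab
  rw [Set.mem_singleton_iff.1 hv₁] at e₁
  rw [Set.mem_singleton_iff.1 hv₂] at e₂
  refine ⟨?_, a • d₁ + b • d₂, ?_, v, rfl, ?_⟩
  · have hL₁ : ∀ x, L₁ x = ξ₁ x • k + v.1 x := fun x => by
      rw [← hξ₁, ← show d₁.1 + v.1 = L₁ from congrArg Prod.fst e₁]; rfl
    have hL₂ : ∀ x, L₂ x = ξ₂ x • k + v.1 x := fun x => by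
      rw [← hξ₂, ← show d₂.1 + v.1 = L₂ from congrArg Prod.fst e₂]; rfl
    have hy₁ : y₁ = r₁ • k + v.2 := by
      rw [← hr₁, ← show d₁.2 + v.2 = y₁ from congrArg Prod.snd e₁]
    have hy₂ : y₂ = r₂ • k + v.2 := by
      rw [← hr₂, ← show d₂.2 + v.2 = y₂ from congrArg Prod.snd e₂]
    change (a • L₁ + b • L₂, a • y₁ + b • y₂) ∈ _
    rw [mem_epiConj_add_indicator_iff hk hF hD] at *
    intro x hx w hw
    have k₁ := h₁ x hx w hw
    have k₂ := h₂ x hx w hw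
    have e : (a • L₁ + b • L₂) x - w - (a • y₁ + b • y₂) =
        (v.1 x - w - v.2) + (a * (ξ₁ x - r₁) + b * (ξ₂ x - r₂)) • k := by
      change a • L₁ x + b • L₂ x - w - (a • y₁ + b • y₂) = _
      obtain rfl : b = 1 - a := by linarith
      rw [hL₁, hL₂, hy₁, hy₂]
      module
    rw [show L₁ x - w - y₁ = (v.1 x - w - v.2) + (ξ₁ x - r₁) • k by
      rw [hL₁, hy₁]; module] at k₁
    rw [show L₂ x - w - y₂ = (v.1 x - w - v.2) + (ξ₂ x - r₂) • k by
      rw [hL₂, hy₂]; module] at k₂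
    rw [e]
    obtain rfl : b = 1 - a := by linarith
    rcases le_total (ξ₁ x - r₁) (ξ₂ x - r₂) with h | h
    · refine add_smul_notMem_interior_of_le hk ?_ k₂
      linarith [mul_le_mul_of_nonneg_left h ha]
    · refine add_smul_notMem_interior_of_le hk ?_ k₁
      linarith [mul_le_mul_of_nonneg_left h hb]
  · exact Submodule.add_mem _ (Submodule.smul_mem _ _ ⟨ξ₁, r₁, hξ₁, hr₁⟩)
      (Submodule.smul_mem _ _ ⟨ξ₂, r₂, hξ₂, hr₂⟩)
  · change a • d₁ + b • d₂ + v = a • (L₁, y₁) + b • (L₂, y₂)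
    rw [← show d₁ + v = (L₁, y₁) from e₁, ← show d₂ + v = (L₂, y₂) from e₂]
    obtain rfl : b = 1 - a := by linarith
    module

omit [ContinuousSMul ℝ Y] in
theorem mem_add_singleton_iff {N : Set ((X →Lₚₜ[ℝ] Y) × Y)} {L : X →Lₚₜ[ℝ] Y} {y v : Y} :
    (L, y) ∈ N + {((0 : X →Lₚₜ[ℝ] Y), v)} ↔ (L, y - v) ∈ N := by
  rw [Set.add_singleton, Set.image_add_right]
  simp [sub_eq_add_neg]

omit [IsTopologicalAddGroup Y] [ContinuousSMul ℝ Y] in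
theorem fin_mem_range_indicator_iff {T : Z →Lₚₜ[ℝ] Y} {v : Y} :
    Ext.fin v ∈ Set.range (fun z => Ext.fin (T z) + -indicator (-(S : Set Z)) z) ↔
      ∃ s ∈ S, v = -T s := by
  rw [fin_mem_range_iff]
  constructor
  · rintro ⟨z, w, hw, rfl⟩
    obtain ⟨hz, rfl⟩ := indicator_eq_fin_iff.1 hw
    exact ⟨-z, hz, by simp⟩
  · rintro ⟨s, hs, rfl⟩
    exact ⟨-s, 0, indicator_eq_fin_iff.2 ⟨by simpa using hs, rfl⟩, by simp⟩

/-- For feasible `x` with `G_u(x) = z`, some `v ∈ I_{-S}*(T)` has `v - T z` a nonnegative multiple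
of `k`. The shift by this `v` therefore compensates the term `T z` in the Lagrangian. -/
theorem weakQualifyingSet_subset {k : Y} (hk : k ∈ interior (K : Set Y))
    (hF : ∀ x, F x ≠ .negInf) (hG : ∀ u x, G u x ≠ .negInf)
    (hA : (feasible S G C ∩ dom F).Nonempty) :
    weakQualifyingSet K S F G C ⊆ epiConj K (F + indicator (feasible S G C)) := by
  rintro ⟨L, y⟩ hp
  simp only [weakQualifyingSet, Set.mem_iUnion, Set.mem_iInter] at hp
  obtain ⟨T, hT, u, hp⟩ := hp
  rw [mem_epiConj_add_indicator_iff hk hF hA]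
  intro x hx a ha hcon
  obtain ⟨hxC, hxG⟩ := mem_feasible_iff.1 hx
  obtain ⟨z, hz, hzS⟩ := mem_epi_iff.1 (hxG u)
  rw [zero_sub] at hzS
  have hTz : Ext.fin (T z) ∈ Set.range (fun z => Ext.fin (T z) + -indicator (-(S : Set Z)) z) :=
    fin_mem_range_indicator_iff.2 ⟨-z, hzS, by simp⟩
  -- Since `T z + t₁ k ∈ int K`, weak positivity makes this point an upper bound of `-T(S)`;
  -- descending from it along `k` reaches `I_{-S}*(T)` without passing `T z`.
  obtain ⟨t₁, -, ht₁⟩ := exists_smul_sub_mem_interior hk (-T z)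
  obtain ⟨t, -, hmem⟩ := exists_sub_smul_mem_wSup hk
    (posInf_notMem_range (fun _ => indicator_ne_negInf)) hTz (y := T z + t₁ • k) (by
      intro v hv hcon
      obtain ⟨s, hs, rfl⟩ := fin_mem_range_indicator_iff.1 hv
      have h := add_mem_interior hcon (interior_subset ht₁)
      have : T s ∈ T '' (S : Set Z) ∩ -interior (K : Set Y) := by
        refine ⟨⟨s, hs, rfl⟩, ?_⟩
        rw [Set.mem_neg]
        convert h using 1
        abel
      rw [hT] at this
      exact this)
  have htt : t ≤ t₁ := by
    by_contra! hlt
    refine hmem.1 _ hTz (wLt_fin_iff.2 ?_)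
    convert smul_mem_interior (sub_pos.2 hlt) hk using 1
    module
  have h := hp _ hmem
  rw [mem_add_singleton_iff, mem_epiConj_lagrangian_iff hk hF hG hA] at h
  refine h x hxC a z ha hz ?_
  convert add_mem_interior hcon (cone_smul_mem (sub_nonneg.2 htt) (interior_subset hk)) using 1
  module

/-- When `T` is positive, every `v ∈ I_{-S}*(T)` is approached by elements of `-T(S) ⊆ -K`, so `-v ∈
K`. Replacing `y` by `y - v` then moves up inside the epigraph. -/
theorem qualifyingSet_subset_weakQualifyingSet (hK : (K : Set Y) ≠ Set.univ) {k : Y}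
    (hk : k ∈ interior (K : Set Y))
    (hF : ∀ x, F x ≠ .negInf) (hG : ∀ u x, G u x ≠ .negInf)
    (hA : (feasible S G C ∩ dom F).Nonempty) :
    qualifyingSet K S F G C ⊆ weakQualifyingSet K S F G C := by
  rintro ⟨L, y⟩ hp
  simp only [qualifyingSet, weakQualifyingSet, Set.mem_iUnion, Set.mem_iInter] at hp ⊢
  obtain ⟨T, hT, u, hp⟩ := hp
  replace hT : ∀ s ∈ S, T s ∈ K := fun s hs => hT ⟨s, hs, rfl⟩
  refine ⟨T, ?_, u, fun v hv => ?_⟩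
  · refine Set.eq_empty_of_forall_notMem ?_
    rintro _ ⟨⟨s, hs, rfl⟩, h⟩
    have := add_mem_interior (Set.mem_neg.1 h) (hT s hs)
    rw [neg_add_cancel] at this
    exact zero_notMem_interior hK this
  · have hvK : -v ∈ K := mem_cone_of_forall_add_smul_mem (k := k) fun ε hε => by
      obtain ⟨m, hm, hlt⟩ := hv.2 (.fin (v - ε • k)) (wLt_fin_iff.2 (by
        simpa using smul_mem_interior hε hk))
      cases m with
      | negInf => exact hlt.elim
      | posInf => exact (posInf_notMem_range (fun _ => indicator_ne_negInf) hm).elim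
      | fin m =>
        obtain ⟨s, hs, rfl⟩ := fin_mem_range_indicator_iff.1 hm
        have := add_mem_interior (wLt_fin_iff.1 hlt) (hT s hs)
        rw [show -T s - (v - ε • k) + T s = -v + ε • k by abel] at this
        exact interior_subset this
    rw [mem_add_singleton_iff]
    rw [mem_epiConj_lagrangian_iff hk hF hG hA] at hp ⊢
    intro x hx a z ha hz hcon
    refine hp x hx a z ha hz ?_
    convert add_mem_interior hcon hvK using 1
    abel

end Lagrangian

/-! ### Epigraphs of scalarized maps -/

section ScalarEpigraph

variable {X Y : Type*} [AddCommGroup X] [Module ℝ X] [TopologicalSpace X]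
  [AddCommGroup Y] [Module ℝ Y] [TopologicalSpace Y]

/-- The epigraph of the scalarization `φ ∘ F`. -/
def scalarEpigraph (φ : Y →L[ℝ] ℝ) (F : X → Ext Y) : Set (X × ℝ) :=
  {p | ∃ a, F p.1 = .fin a ∧ φ a ≤ p.2}

omit [AddCommGroup X] [Module ℝ X] in
theorem isClosed_scalarEpigraph {φ : Y →L[ℝ] ℝ} {F : X → Ext Y} (hF : ∀ x, F x ≠ .negInf)
    (hlsc : LowerSemicontinuous fun x => (F x).toEReal φ) : IsClosed (scalarEpigraph φ F) := by
  have hc : Continuous fun p : X × ℝ => (p.1, (p.2 : EReal)) :=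
    continuous_fst.prodMk (continuous_coe_real_ereal.comp continuous_snd)
  have : scalarEpigraph φ F = (fun p : X × ℝ => (p.1, (p.2 : EReal))) ⁻¹'
      {p : X × EReal | (F p.1).toEReal φ ≤ p.2} := by
    ext ⟨x, t⟩
    have := hF x
    simp only [scalarEpigraph, Set.mem_preimage, Set.mem_ofPred_eq]
    cases h : F x <;> simp_all [Ext.toEReal]
  rw [this]
  exact hlsc.isClosed_epigraph.preimage hc

omit [TopologicalSpace X] in
theorem convex_scalarEpigraph {K : ProperCone ℝ Y} {φ : Y →L[ℝ] ℝ} (hφ : ∀ c ∈ K, 0 ≤ φ c)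
    {F : X → Ext Y} (hF : KConvex K F) : Convex ℝ (scalarEpigraph φ F) := by
  rintro ⟨x, s⟩ ⟨v, hv, hs⟩ ⟨y, t⟩ ⟨w, hw, ht⟩ a b ha hb hab
  have h := hF (x := (x, v)) (mem_epi_iff.2 ⟨v, hv, by simp⟩)
    (y := (y, w)) (mem_epi_iff.2 ⟨w, hw, by simp⟩) ha hb hab
  obtain ⟨z, hz, hzK⟩ := mem_epi_iff.1 h
  refine ⟨z, hz, ?_⟩
  have := hφ _ hzK
  change 0 ≤ φ (a • v + b • w - z) at this
  rw [map_sub, map_add, map_smul, map_smul, smul_eq_mul, smul_eq_mul] at this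
  have h₁ := mul_le_mul_of_nonneg_left hs ha
  have h₂ := mul_le_mul_of_nonneg_left ht hb
  change φ z ≤ a * s + b * t
  simp only at h₁ h₂
  linarith

end ScalarEpigraph

/-! ### Scalar Lagrangian duality and scalarization -/

section Scalarization

variable {X Y Z U : Type*}
  [AddCommGroup X] [Module ℝ X] [TopologicalSpace X] [IsTopologicalAddGroup X]
  [ContinuousSMul ℝ X] [LocallyConvexSpace ℝ X]
  [AddCommGroup Y] [Module ℝ Y] [TopologicalSpace Y] [IsTopologicalAddGroup Y] [ContinuousSMul ℝ Y]
  [AddCommGroup Z] [Module ℝ Z] [TopologicalSpace Z] [IsTopologicalAddGroup Z]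
  [ContinuousSMul ℝ Z] [LocallyConvexSpace ℝ Z]
  {K : ProperCone ℝ Y} {S : ProperCone ℝ Z} {F : X → Ext Y} {G : U → X → Ext Z} {C : Set X}

/-- The union of the epigraphs of the conjugates of the scalar Lagrangians
`φ ∘ F + I_C + ζ ∘ G_u`, with `ζ` in the dual cone of `S`. -/
def scalarQualifyingSet (S : ProperCone ℝ Z) (φ : Y →L[ℝ] ℝ) (F : X → Ext Y)
    (G : U → X → Ext Z) (C : Set X) : Set ((X →Lₚₜ[ℝ] ℝ) × ℝ) :=
  {p | ∃ (u : U) (ζ : Z →L[ℝ] ℝ), (∀ s ∈ S, 0 ≤ ζ s) ∧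
    ∀ x ∈ C, ∀ a z, F x = .fin a → G u x = .fin z → p.1 x - p.2 ≤ φ a + ζ z}

omit [IsTopologicalAddGroup Y] [ContinuousSMul ℝ Y] in
/-- The support function of the scalar qualifying set dominates `φ ∘ F + I_A`. -/
theorem mem_feasible_of_forall_le [Nonempty U] (hF : ∀ x, F x ≠ .negInf) (hFdom : (dom F).Nonempty)
    (hG : ∀ u, IsProper (G u)) (hFconv : KConvex K F) (hFlsc : PositivelyLsc K F)
    (hGconv : ∀ u, KConvex S (G u)) (hGclosed : ∀ u, KEpiClosed S (G u))
    (hCclosed : IsClosed C) (hCconv : Convex ℝ C)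
    {φ : Y →L[ℝ] ℝ} (hφ : ∀ c ∈ K, 0 ≤ φ c) (hφ0 : φ ≠ 0) {x₀ : X} {M : ℝ}
    (h : ∀ p ∈ scalarQualifyingSet S φ F G C, p.1 x₀ - p.2 ≤ M) :
    x₀ ∈ feasible S G C ∧ ∃ a, F x₀ = .fin a ∧ φ a ≤ M := by
  have u₀ : U := Classical.arbitrary U
  obtain ⟨x₁, hx₁⟩ := hFdom
  obtain ⟨a₁, ha₁⟩ := exists_eq_fin (hF x₁) hx₁
  have hminor : ∀ x M, (x, M) ∉ scalarEpigraph φ F → ∃ (ξ : X →L[ℝ] ℝ) (r : ℝ),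
      (∀ x a, F x = .fin a → ξ x - r ≤ φ a) ∧ M < ξ x - r := by
    intro x M hx
    obtain ⟨ξ, r, h₁, h₂⟩ := exists_affine_minorant_gt
      (isClosed_scalarEpigraph hF (hFlsc φ hφ hφ0)) (convex_scalarEpigraph hφ hFconv)
      (fun x t ⟨a, ha, hat⟩ s hts => ⟨a, ha, hat.trans hts⟩)
      (a := x₁) (b := φ a₁) (c := φ a₁ - 1) ⟨a₁, ha₁, le_rfl⟩
      (by
        rintro ⟨a, ha, hle⟩
        rw [ha₁] at ha
        obtain rfl := Ext.fin.inj ha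
        simp only at hle
        linarith) hx
    exact ⟨ξ, r, fun x a ha => h₁ x _ ⟨a, ha, le_rfl⟩, h₂⟩
  -- Affine minorants of `φ ∘ F` belong to the scalar qualifying set with `ζ = 0`, and they recover
  -- `φ ∘ F`.
  have hmem : (x₀, M) ∈ scalarEpigraph φ F := by
    by_contra hcon
    obtain ⟨ξ, r, h₁, h₂⟩ := hminor _ _ hcon
    have := h (ContinuousLinearMap.toPointwiseConvergenceCLM ℝ (RingHom.id ℝ) X ℝ ξ, r)
      ⟨u₀, 0, by simp, fun x _ a z ha _ => by
        rw [zero_apply, add_zero]; exact h₁ x a ha⟩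
    change ξ x₀ - r ≤ M at this
    linarith
  obtain ⟨ξ, r, hξ, -⟩ := hminor x₁ (φ a₁ - 1) (by
    rintro ⟨a, ha, hle⟩
    rw [ha₁] at ha
    obtain rfl := Ext.fin.inj ha
    simp only at hle
    linarith)
  -- Any nonnegative multiple of `c - η` can be added to the fixed minorant `ξ - r` inside the
  -- scalar qualifying set; the bound `M` at `x₀` then forces `c - η x₀ ≤ 0`.
  have key : ∀ (u : U) (ζ : Z →L[ℝ] ℝ) (η : X →L[ℝ] ℝ) (c : ℝ), (∀ s ∈ S, 0 ≤ ζ s) →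
      (∀ x ∈ C, ∀ z, G u x = .fin z → c - η x ≤ ζ z) → c - η x₀ ≤ 0 := by
    intro u ζ η c hζ hle
    by_contra! hpos
    have hB : ∀ t : ℝ, 0 ≤ t → ξ x₀ - r + t * (c - η x₀) ≤ M := fun t ht => by
      have := h (ContinuousLinearMap.toPointwiseConvergenceCLM ℝ (RingHom.id ℝ) X ℝ (ξ - t • η),
        r - t * c) ⟨u, t • ζ, fun s hs => mul_nonneg ht (hζ s hs), fun x hx a z ha hz => by
          have h₁ := hξ x a ha
          have h₂ := mul_le_mul_of_nonneg_left (hle x hx z hz) ht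
          change ξ x - t * η x - (r - t * c) ≤ φ a + t * ζ z
          linarith⟩
      change ξ x₀ - t * η x₀ - (r - t * c) ≤ M at this
      linarith
    have := hB ((|M - (ξ x₀ - r)| + 1) / (c - η x₀)) (by positivity)
    rw [div_mul_cancel₀ _ hpos.ne'] at this
    linarith [le_abs_self (M - (ξ x₀ - r))]
  obtain ⟨a, ha, haM⟩ := hmem
  refine ⟨mem_feasible_iff.2 ⟨?_, fun u => ?_⟩, a, ha, haM⟩
  · by_contra hcon
    obtain ⟨f, c, hfC, hfx⟩ := geometric_hahn_banach_closed_point hCconv hCclosed hcon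
    have := key u₀ 0 (-f) (-c) (by simp) fun x hx z _ => by
      have := hfC x hx
      simp only [neg_apply, zero_apply]
      linarith
    simp only [neg_apply] at this
    linarith
  · by_contra hcon
    obtain ⟨f, c, hfx, hf⟩ := geometric_hahn_banach_point_closed (hGconv u) (hGclosed u) hcon
    have hsplit : ∀ x z, f (x, z) = f (x, 0) + f (0, z) := fun x z => by
      rw [← map_add]; simp
    -- The epigraph is stable under adding `(0, s)`, so a functional bounded below on it is
    -- nonnegative on `S`.
    have hS : ∀ s ∈ S, 0 ≤ f (0, s) := by
      intro s hs
      obtain ⟨x₂, hx₂⟩ := (hG u).1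
      obtain ⟨z₂, hz₂⟩ := exists_eq_fin ((hG u).2 x₂) hx₂
      by_contra! hneg
      have hle : ∀ t : ℝ, 0 ≤ t → c < f (x₂, z₂) + t * f (0, s) := fun t ht => by
        have := hf (x₂, z₂ + t • s) (mem_epi_iff.2 ⟨z₂, hz₂, by
          simpa using cone_smul_mem ht hs⟩)
        rw [show (x₂, z₂ + t • s) = (x₂, z₂) + t • ((0 : X), s) by simp, map_add, map_smul] at this
        exact this
      have h0 := hle 0 le_rfl
      have h1 := hle ((f (x₂, z₂) - c) / (-f (0, s)))
        (div_nonneg (by linarith) (by linarith))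
      rw [div_neg, neg_mul, div_mul_cancel₀ _ hneg.ne] at h1
      linarith
    have := key u (f.comp (ContinuousLinearMap.inr ℝ X Z)) (f.comp (ContinuousLinearMap.inl ℝ X Z)) c
      hS fun x _ z hz => by
        have := hf (x, z) (mem_epi_iff.2 ⟨z, hz, by simp⟩)
        rw [hsplit] at this
        change c - f (x, 0) ≤ f (0, z)
        linarith
    change c - f (x₀, 0) ≤ 0 at this
    linarith

omit [IsTopologicalAddGroup X] [ContinuousSMul ℝ X] [LocallyConvexSpace ℝ X] in
/-- A convex weakly efficient problem admits a normalized scalarization. -/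
theorem exists_scalarization {k : Y} (hk : k ∈ interior (K : Set Y)) {D : Set X}
    (hD : Convex ℝ D) (hF : KConvex K F) {x₁ : X} {a₁ : Y} (hx₁ : x₁ ∈ D) (ha₁ : F x₁ = .fin a₁)
    {L : X →Lₚₜ[ℝ] Y} {y : Y}
    (h : ∀ x ∈ D, ∀ a, F x = .fin a → L x - a - y ∉ interior (K : Set Y)) :
    ∃ φ : Y →L[ℝ] ℝ, (∀ c ∈ K, 0 ≤ φ c) ∧ φ k = 1 ∧
      ∀ x ∈ D, ∀ a, F x = .fin a → φ (L x) - φ y ≤ φ a := by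
  -- Using the whole epigraph rather than only the values of `F` makes `P` convex; it still misses
  -- `int K` because `int K + K ⊆ int K`.
  set P : Set Y := {p | ∃ x ∈ D, ∃ w, (x, w) ∈ epi K F ∧ p = L x - w - y}
  have hP : Convex ℝ P := by
    rintro _ ⟨x, hx, v, hv, rfl⟩ _ ⟨x', hx', v', hv', rfl⟩ a b ha hb hab
    refine ⟨_, hD hx hx' ha hb hab, _, hF hv hv' ha hb hab, ?_⟩
    obtain rfl : b = 1 - a := by linarith
    change _ = L (a • x + (1 - a) • x') - (a • v + (1 - a) • v') - y
    rw [map_add, map_smul, map_smul]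
    module
  have hmemP : ∀ x ∈ D, ∀ a, F x = .fin a → L x - a - y ∈ P := fun x hx a ha =>
    ⟨x, hx, a, mem_epi_iff.2 ⟨a, ha, by simp⟩, rfl⟩
  have hdisj : Disjoint P (interior (K : Set Y)) := by
    rw [Set.disjoint_left]
    rintro _ ⟨x, hx, w, hw, rfl⟩ hcon
    obtain ⟨a, ha, haw⟩ := mem_epi_iff.1 hw
    refine h x hx a ha ?_
    convert add_mem_interior hcon haw using 1
    abel
  obtain ⟨f, u, hfP, hfK⟩ := geometric_hahn_banach_open K.convex.interior isOpen_interior hP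
    hdisj.symm
  obtain ⟨b, hb⟩ : P.Nonempty := ⟨_, hmemP x₁ hx₁ a₁ ha₁⟩
  have hneg : ∀ c ∈ K, f c ≤ 0 := by
    intro c hc
    by_contra! hpos
    have hle : ∀ t : ℝ, 0 ≤ t → f k + t * f c < u := fun t ht => by
      have := hfP _ (add_mem_interior hk (cone_smul_mem ht hc))
      rwa [map_add, map_smul, smul_eq_mul] at this
    have h0 := hle 0 le_rfl
    have h1 := hle ((u - f k) / f c) (div_nonneg (by linarith) hpos.le)
    rw [div_mul_cancel₀ _ hpos.ne'] at h1
    linarith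
  -- The functional is below `u` on `int K` and tends to `0` along `t k` as `t → 0`.
  have hu : 0 ≤ u := by
    by_contra! hu
    have h0 := hfP k hk
    have h1 := hfP _ (smul_mem_interior (t := u / (2 * f k))
      (div_pos_of_neg_of_neg hu (by linarith)) hk)
    have e : u / (2 * f k) * f k = u / 2 := by
      have : f k ≠ 0 := by linarith
      field_simp
    rw [map_smul, smul_eq_mul, e] at h1
    linarith
  have hne : -f ≠ 0 := by
    intro h0
    have := (hfP k hk).trans_le (hfK b hb)
    rw [neg_eq_zero.1 h0] at this
    simp at this
  have hk' := pos_of_mem_interior (K := K) (φ := -f)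
    (fun c hc => by simpa using hneg c hc) hne hk
  rw [neg_apply] at hk'
  refine ⟨(-f k)⁻¹ • -f, fun c hc => ?_, ?_, fun x hx a ha => ?_⟩
  · exact mul_nonneg (inv_nonneg.2 hk'.le) (by simpa using hneg c hc)
  · exact inv_mul_cancel₀ hk'.ne'
  · have h0 := hu.trans (hfK _ (hmemP x hx a ha))
    rw [map_sub, map_sub] at h0
    have h1 := mul_nonneg (inv_nonneg.2 hk'.le) h0
    change (-f k)⁻¹ * -f (L x) - (-f k)⁻¹ * -f y ≤ (-f k)⁻¹ * -f a
    linarith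

end Scalarization

/-! ### Sections in the directions of `E_k` -/

section Sectional

variable {X Y : Type*}
  [AddCommGroup X] [Module ℝ X] [TopologicalSpace X]
  [AddCommGroup Y] [Module ℝ Y] [TopologicalSpace Y] [IsTopologicalAddGroup Y] [ContinuousSMul ℝ Y]

/-- The affine parametrization `(ξ, r) ↦ (L + (ξ - φ ∘ L) k, y + (r - φ y) k)` of the section of
`ℒ(X, Y) × Y` through `(L, y)` in the directions of `E_k`. -/
noncomputable def sectionMap (φ : Y →L[ℝ] ℝ) (k : Y) (L : X →Lₚₜ[ℝ] Y) (y : Y)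
    (p : (X →Lₚₜ[ℝ] ℝ) × ℝ) : (X →Lₚₜ[ℝ] Y) × Y :=
  (L + PointwiseConvergenceCLM.postcomp X (ContinuousLinearMap.toSpanSingleton ℝ k)
    (p.1 - PointwiseConvergenceCLM.postcomp X φ L), y + (p.2 - φ y) • k)

variable {φ : Y →L[ℝ] ℝ} {k : Y} {L : X →Lₚₜ[ℝ] Y} {y : Y}

theorem sectionMap_fst_apply (p : (X →Lₚₜ[ℝ] ℝ) × ℝ) (x : X) :
    (sectionMap φ k L y p).1 x = L x + (p.1 x - φ (L x)) • k := rfl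

theorem sectionMap_snd (p : (X →Lₚₜ[ℝ] ℝ) × ℝ) :
    (sectionMap φ k L y p).2 = y + (p.2 - φ y) • k := rfl

theorem continuous_sectionMap : Continuous (sectionMap φ k L y) := by
  unfold sectionMap
  fun_prop

theorem sectionMap_combo (p q : (X →Lₚₜ[ℝ] ℝ) × ℝ) {a b : ℝ} (hab : a + b = 1) :
    sectionMap φ k L y (a • p + b • q) = a • sectionMap φ k L y p + b • sectionMap φ k L y q := by
  obtain rfl : b = 1 - a := by linarith
  refine Prod.ext (DFunLike.ext _ _ fun x => ?_) ?_
  · change L x + (a * p.1 x + (1 - a) * q.1 x - φ (L x)) • k =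
      a • (L x + (p.1 x - φ (L x)) • k) + (1 - a) • (L x + (q.1 x - φ (L x)) • k)
    module
  · change y + (a * p.2 + (1 - a) * q.2 - φ y) • k =
      a • (y + (p.2 - φ y) • k) + (1 - a) • (y + (q.2 - φ y) • k)
    module

variable [IsTopologicalAddGroup X] [ContinuousSMul ℝ X]

theorem sectionMap_mem (p : (X →Lₚₜ[ℝ] ℝ) × ℝ) :
    sectionMap φ k L y p ∈ (directionSpace X k : Set ((X →Lₚₜ[ℝ] Y) × Y)) + {(L, y)} := by
  refine ⟨sectionMap φ k L y p - (L, y), ⟨p.1 - PointwiseConvergenceCLM.postcomp X φ L, p.2 - φ y,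
    fun x => ?_, ?_⟩, _, rfl, sub_add_cancel _ _⟩
  · change L x + (p.1 x - φ (L x)) • k - L x = (p.1 x - φ (L x)) • k
    abel
  · change y + (p.2 - φ y) • k - y = _
    abel

/-- Sectionally convex hulls absorb the images of convex hulls under `sectionMap`. -/
theorem sectionMap_mem_sco {N : Set ((X →Lₚₜ[ℝ] Y) × Y)} {B : Set ((X →Lₚₜ[ℝ] ℝ) × ℝ)}
    (hB : ∀ p ∈ B, sectionMap φ k L y p ∈ N) {p : (X →Lₚₜ[ℝ] ℝ) × ℝ}
    (hp : p ∈ convexHull ℝ B) : sectionMap φ k L y p ∈ sco k N := by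
  rintro M ⟨hNM, hM⟩
  refine convexHull_min (t := sectionMap φ k L y ⁻¹' M) (fun q hq => hNM (hB q hq)) ?_ hp
  intro q hq r hr a b ha hb hab
  rw [Set.mem_preimage, sectionMap_combo q r hab]
  exact (hM (L, y) ⟨hq, sectionMap_mem q⟩ ⟨hr, sectionMap_mem r⟩ ha hb hab).1

theorem sco_mono {N N' : Set ((X →Lₚₜ[ℝ] Y) × Y)} (h : N ⊆ N') : sco k N ⊆ sco k N' :=
  Set.sInter_subset_sInter fun _ hM => ⟨h.trans hM.1, hM.2⟩

theorem sco_subset {N M : Set ((X →Lₚₜ[ℝ] Y) × Y)} (h : N ⊆ M)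
    (hM : SectionallyConvex (directionSpace X k) M) : sco k N ⊆ M :=
  Set.sInter_subset_of_mem ⟨h, hM⟩

end Sectional

/-! ### From the scalar hull to the vector hull -/

section Main

variable {X Y Z U : Type*}
  [AddCommGroup X] [Module ℝ X] [TopologicalSpace X] [IsTopologicalAddGroup X]
  [ContinuousSMul ℝ X] [LocallyConvexSpace ℝ X]
  [AddCommGroup Y] [Module ℝ Y] [TopologicalSpace Y] [IsTopologicalAddGroup Y] [ContinuousSMul ℝ Y]
  [AddCommGroup Z] [Module ℝ Z] [TopologicalSpace Z] [IsTopologicalAddGroup Z]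
  [ContinuousSMul ℝ Z] [LocallyConvexSpace ℝ Z]
  {K : ProperCone ℝ Y} {S : ProperCone ℝ Z} {F : X → Ext Y} {G : U → X → Ext Z} {C : Set X}

theorem epiConj_subset_closure_sco_qualifyingSet [Nonempty U] {k : Y}
    (hk : k ∈ interior (K : Set Y)) (hF : ∀ x, F x ≠ .negInf) (hG : ∀ u, IsProper (G u))
    (hA : (feasible S G C ∩ dom F).Nonempty) (hFconv : KConvex K F) (hFlsc : PositivelyLsc K F)
    (hGconv : ∀ u, KConvex S (G u)) (hGclosed : ∀ u, KEpiClosed S (G u))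
    (hCclosed : IsClosed C) (hCconv : Convex ℝ C) :
    epiConj K (F + indicator (feasible S G C)) ⊆ closure (sco k (qualifyingSet K S F G C)) := by
  rintro ⟨L, y⟩ hp
  rw [mem_epiConj_add_indicator_iff hk hF hA] at hp
  have hA' := hA
  obtain ⟨x₁, hx₁, hx₁'⟩ := hA'
  obtain ⟨a₁, ha₁⟩ := exists_eq_fin (hF x₁) hx₁'
  obtain ⟨φ, hφ, hφk, hφA⟩ := exists_scalarization hk (convex_feasible hGconv hCconv) hFconv
    hx₁ ha₁ hp
  have hφ0 : φ ≠ 0 := by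
    rintro rfl
    simp at hφk
  set B := scalarQualifyingSet S φ F G C
  have hdom : ∀ {x M}, (∀ p ∈ B, p.1 x - p.2 ≤ M) →
      x ∈ feasible S G C ∧ ∃ a, F x = .fin a ∧ φ a ≤ M :=
    mem_feasible_of_forall_le hF ⟨x₁, hx₁'⟩ hG hFconv hFlsc hGconv hGclosed hCclosed hCconv hφ hφ0
  set q : (X →Lₚₜ[ℝ] ℝ) × ℝ := (PointwiseConvergenceCLM.postcomp X φ L, φ y)
  have hq : q ∈ closure (convexHull ℝ B) := by
    refine mem_closure_convexHull_of_forall_le (a := x₁) (m := φ a₁) ?_ ?_ ?_ ?_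
    -- If `B` were empty, every bound would hold vacuously, including the false `φ a₁ ≤ φ a₁ - 1`.
    · by_contra hempty
      rw [Set.not_nonempty_iff_eq_empty] at hempty
      obtain ⟨-, a, ha, hle⟩ := hdom (x := x₁) (M := φ a₁ - 1) (by simp [hempty])
      rw [ha₁] at ha
      obtain rfl := Ext.fin.inj ha
      linarith
    · rintro p ⟨u, ζ, hζ, h⟩ t ht
      refine ⟨u, ζ, hζ, fun x hx a z ha hz => ?_⟩
      have := h x hx a z ha hz
      dsimp only
      linarith
    · rintro p ⟨u, ζ, hζ, h⟩
      obtain ⟨hxC, hxG⟩ := mem_feasible_iff.1 hx₁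
      obtain ⟨z, hz, hzS⟩ := mem_epi_iff.1 (hxG u)
      have h1 := h x₁ hxC a₁ z ha₁ hz
      have h2 := hζ _ hzS
      rw [zero_sub, map_neg] at h2
      linarith
    · intro x M hM
      obtain ⟨hx, a, ha, hle⟩ := hdom hM
      exact (hφA x hx a ha).trans hle
  have hB : ∀ p ∈ B, sectionMap φ k L y p ∈ qualifyingSet K S F G C := by
    rintro p ⟨u, ζ, hζ, h⟩
    simp only [qualifyingSet, Set.mem_iUnion]
    refine ⟨ContinuousLinearMap.toPointwiseConvergenceCLM ℝ (RingHom.id ℝ) Z Y (ζ.smulRight k),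
      ?_, u, ?_⟩
    · rintro _ ⟨s, hs, rfl⟩
      exact cone_smul_mem (hζ s hs) (interior_subset hk)
    · rw [← Prod.mk.eta (p := sectionMap φ k L y p),
        mem_epiConj_lagrangian_iff hk hF (fun u => (hG u).2) hA]
      intro x hx a z ha hz hcon
      -- As `φ k = 1`, applying `φ` to the section point returns `p`, so a value in `int K` would
      -- contradict the scalar Lagrangian inequality.
      have hpos := pos_of_mem_interior hφ hφ0 hcon
      rw [sectionMap_fst_apply, sectionMap_snd] at hpos
      change 0 < φ (L x + (p.1 x - φ (L x)) • k - (a + ζ z • k) - (y + (p.2 - φ y) • k)) at hpos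
      simp only [map_sub, map_add, map_smul, hφk, smul_eq_mul, mul_one] at hpos
      linarith [h x hx a z ha hz]
  have hqL : sectionMap φ k L y q = (L, y) := by
    simp only [sectionMap, q, sub_self, map_zero, add_zero, zero_smul]
  rw [← hqL]
  exact map_mem_closure continuous_sectionMap hq fun p hp => sectionMap_mem_sco hB hp

end Main

end RobustVector

theorem theorem4p2
    {X Y Z U : Type*}
    [AddCommGroup X] [Module ℝ X] [TopologicalSpace X] [IsTopologicalAddGroup X]
    [ContinuousSMul ℝ X] [LocallyConvexSpace ℝ X] [T2Space X]
    [AddCommGroup Y] [Module ℝ Y] [TopologicalSpace Y] [IsTopologicalAddGroup Y]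
    [ContinuousSMul ℝ Y] [LocallyConvexSpace ℝ Y] [T2Space Y]
    [AddCommGroup Z] [Module ℝ Z] [TopologicalSpace Z] [IsTopologicalAddGroup Z]
    [ContinuousSMul ℝ Z] [LocallyConvexSpace ℝ Z] [T2Space Z]
    [Nonempty U]
    (K : ProperCone ℝ Y) (hK : (K : Set Y) ≠ Set.univ) (hKint : (interior (K : Set Y)).Nonempty)
    (S : ProperCone ℝ Z)
    (F : X → RobustVector.Ext Y) (hF : RobustVector.IsProper F)
    (G : U → X → RobustVector.Ext Z) (hG : ∀ u, RobustVector.IsProper (G u))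
    (C : Set X)
    (hA : (RobustVector.feasible S G C ∩ RobustVector.dom F).Nonempty)
    (hFconv : RobustVector.KConvex K F) (hFlsc : RobustVector.PositivelyLsc K F)
    (hGconv : ∀ u, RobustVector.KConvex S (G u))
    (hGclosed : ∀ u, RobustVector.KEpiClosed S (G u))
    (hCne : C.Nonempty) (hCclosed : IsClosed C) (hCconv : Convex ℝ C) :
    ∀ k ∈ interior (K : Set Y),
      RobustVector.epiConj K (F + RobustVector.indicator (RobustVector.feasible S G C)) =
          closure (RobustVector.sco k (RobustVector.weakQualifyingSet K S F G C)) ∧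
        closure (RobustVector.sco k (RobustVector.weakQualifyingSet K S F G C)) =
          closure (RobustVector.sco k (RobustVector.qualifyingSet K S F G C)) := by
  intro k hk
  have hBsub := RobustVector.weakQualifyingSet_subset hk hF.2 (fun u => (hG u).2) hA
  have hAB := RobustVector.qualifyingSet_subset_weakQualifyingSet hK hk hF.2
    (fun u => (hG u).2) hA
  have hcl : closure (RobustVector.sco k (RobustVector.weakQualifyingSet K S F G C)) ⊆
      RobustVector.epiConj K (F + RobustVector.indicator (RobustVector.feasible S G C)) :=
    closure_minimal (RobustVector.sco_subset hBsub
      (RobustVector.sectionallyConvex_epiConj_add_indicator hk hF.2 hA))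
      (RobustVector.isClosed_epiConj_add_indicator hk hF.2 hA)
  have hmain := RobustVector.epiConj_subset_closure_sco_qualifyingSet hk hF.2 hG hA hFconv hFlsc
    hGconv hGclosed hCclosed hCconv
  have hmono := closure_mono (RobustVector.sco_mono (k := k) hAB)
  exact ⟨(hmain.trans hmono).antisymm hcl, (hcl.trans hmain).antisymm hmono⟩
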